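/- There is an absolute constant $c>0$ such that the following holds. Let $f_1,\dots,f_n:\mathbb R^p\to\mathbb R$ be quadratic functions, i.e. $f_i(\theta)=\tfrac12\langle\theta,A_i\theta\rangle+\langle b_i,\theta\rangle+d_i$ with $A_i$ symmetric, let $f=\frac1n\sum_{i=1}^n f_i$, let $\theta_*\in\mathbb R^p$ be a minimizer of $f$ over $\mathbb R^p$, and let $\mathcal C\subseteq\mathbb R^p$ be a closed convex set with $\theta_*\in\mathcal C$. Assume $\|\nabla^2 f_i(\theta)\|_2\le K$ for all $i$ and all $\theta\in\mathcal C$. Let the sub-samples $S_0,S_1,\dots$ of $[n]=\{1,\dots,n\}$, of given sizes $|S_t|\ge 1$, be independent, each drawn uniformly with or without replacement. Fix a rank threshold $0\le r<p$, a starting point $\hat\theta^0\in\mathbb R^p$ and (possibly random) step sizes $\eta_t$, and let $\hat\theta^t$ be the NewSamp iterates $$\hat\theta^{t+1}=\mathcal P_{\mathcal C}\big(\hat\theta^t-\eta_t\mathbf Q^t\nabla f(\hat\theta^t)\big),\qquad \mathbf Q^t=(\lambda^t_{r+1})^{-1}I+\mathbf U_r\big(\mathbf\Lambda_r^{-1}-(\lambda^t_{r+1})^{-1}I_r\big)\mathbf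 U_r^T,$$ where $\mathcal P_{\mathcal C}$ is the Euclidean projection onto $\mathcal C$, $\lambda^t_1\ge\dots\ge\lambda^t_p$ are the eigenvalues of $\mathbf H_{S_t}(\hat\theta^t)=\frac1{|S_t|}\sum_{i\in S_t}\nabla^2 f_i(\hat\theta^t)$, and $\mathbf\Lambda_r=\mathrm{diag}(\lambda^t_1,\dots,\lambda^t_r)$ and $\mathbf U_r\in\mathbb R^{p\times r}$ contain its $r$ largest eigenvalues and corresponding orthonormal eigenvectors (with the convention $0^{-1}=0$ at degenerate steps). Let $t\ge0$, and suppose that almost surely, whenever $\lambda^t_{r+1}>0$, $$0\le\eta_t\le\frac{2}{1+\lambda^t_p/\lambda^t_{r+1}}.$$ Then, with probability at least $1-2/p$, the following holds provided that $\lambda^t_{r+1}>0$ (so that $\mathbf Q^t$ is properly defined): $$\|\hat\theta^{t+1}-\theta_*\|_2\le\xi_1^t\,\|\hat\theta^t-\theta_*\|_2,\qquad \xi_1^t=1-\eta_t\frac{\lambda^t_p}{\lambda^t_{r+1}}+\eta_t\frac{cK}{\lambda^t_{r+1}}\sqrt{\frac{\log p}{|S_t|}}.$$ That is, the event "$\lambda^t_{r+1}\le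 0$ or the bound holds" has probability at least $1-2/p$; if $\lambda^t_{r+1}>0$ almost surely, the bound itself has probability at least $1-2/p$. -/

import Mathlib

open MeasureTheory ProbabilityTheory

noncomputable section

namespace NewSamp

/-- Real `p`-space with the Euclidean norm. Continuous linear maps `E p →L[ℝ] E p` play the role of
real `p × p` matrices; their norm is the spectral norm. -/
abbrev E (p : ℕ) : Type := EuclideanSpace ℝ (Fin p)

/-- The objective: the average of the functions `f i`. -/
def objective {p n : ℕ} (f : Fin n → E p → ℝ) (θ : E p) : ℝ :=
  (n : ℝ)⁻¹ * ∑ i, f i θ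

/-- The Hessian of `g` at `θ`, as the derivative of the gradient. -/
def hessian {p : ℕ} (g : E p → ℝ) (θ : E p) : E p →L[ℝ] E p :=
  fderiv ℝ (gradient g) θ

/-- A quadratic function: half a symmetric quadratic form, plus a linear form, plus a constant. -/
def IsQuadratic {p : ℕ} (g : E p → ℝ) : Prop :=
  ∃ (A : E p →L[ℝ] E p) (b : E p) (d : ℝ), (A : E p →ₗ[ℝ] E p).IsSymmetric ∧
    ∀ θ, g θ = (1 / 2) * inner ℝ θ (A θ) + inner ℝ b θ + d

/-- The sub-sampled Hessian at `θ`; the sub-sample of size `m` is listed as `s 0, …, s (m - 1)`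
(with multiplicity, if indices repeat). -/
def subHessian {p n m : ℕ} (f : Fin n → E p → ℝ) (s : Fin m → Fin n) (θ : E p) :
    E p →L[ℝ] E p :=
  (m : ℝ)⁻¹ • ∑ j, hessian (f (s j)) θ

open Classical in
/-- The eigenvalues of a symmetric `T` in decreasing order, with multiplicity:
`lam T i` is the `(i + 1)`-th largest one (indices start at `0`). -/
def lam {p : ℕ} (T : E p →L[ℝ] E p) (i : Fin p) : ℝ :=
  if h : (T : E p →ₗ[ℝ] E p).IsSymmetric then h.eigenvalues finrank_euclideanSpace_fin i else 0

/-- The smallest eigenvalue of a symmetric `T`, i.e. the `p`-th one. -/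
def lamMin {p : ℕ} (hp : 0 < p) (T : E p →L[ℝ] E p) : ℝ :=
  lam T ⟨p - 1, Nat.sub_lt hp Nat.one_pos⟩

open Classical in
/-- Orthonormal eigenvectors of a symmetric `T`, `eigvec T i` belonging to `lam T i`. -/
def eigvec {p : ℕ} (T : E p →L[ℝ] E p) (i : Fin p) : E p :=
  if h : (T : E p →ₗ[ℝ] E p).IsSymmetric then h.eigenvectorBasis finrank_euclideanSpace_fin i
  else 0

/-- The scaling matrix `λ_{r+1}⁻¹ I + U_r (Λ_r⁻¹ - λ_{r+1}⁻¹ I_r) U_rᵀ` of NewSamp with rank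
threshold `r < p`, where `U_r`, `Λ_r` collect the top `r` eigenvectors and eigenvalues of `T`. -/
def scaling {p : ℕ} (r : Fin p) (T : E p →L[ℝ] E p) : E p →L[ℝ] E p :=
  (lam T r)⁻¹ • ContinuousLinearMap.id ℝ (E p) +
    ∑ i ∈ Finset.Iio r,
      ((lam T i)⁻¹ - (lam T r)⁻¹) • InnerProductSpace.rankOne ℝ (eigvec T i) (eigvec T i)

/-- Euclidean projection: a point of `C` that is nearest to `x` (it exists and is unique when `C` is
nonempty, closed and convex). -/
def proj {p : ℕ} (C : Set (E p)) (x : E p) : E p :=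
  Classical.epsilon fun y => y ∈ C ∧ ∀ z ∈ C, ‖x - y‖ ≤ ‖x - z‖

/-- The NewSamp iterates with feasible set `C`, rank threshold `r`, step sizes `η`, sub-samples `s`
(of sizes `m`) and starting point `θ₀`. -/
def iterate {p n : ℕ} (f : Fin n → E p → ℝ) (C : Set (E p)) (r : Fin p) (θ₀ : E p)
    (η : ℕ → ℝ) {m : ℕ → ℕ} (s : ∀ t, Fin (m t) → Fin n) : ℕ → E p
  | 0 => θ₀
  | t + 1 =>
    let θ := iterate f C r θ₀ η s t
    proj C (θ - η t • scaling r (subHessian f (s t) θ) (gradient (objective f) θ))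

/-- Independent sub-sampling: the samples `S t` are independent, and each `S t` is drawn uniformly
from `[n]`, either with replacement (uniform on all lists of `m t` indices) or without replacement
(uniform on all lists of `m t` distinct indices). -/
structure IsIndependentSubsampling {Ω : Type*} [MeasurableSpace Ω] (P : Measure Ω) {n : ℕ}
    {m : ℕ → ℕ} (S : ∀ t, Ω → Fin (m t) → Fin n) : Prop where
  measurable : ∀ t, Measurable (S t)
  indep : iIndepFun S P
  uniform : ∀ t, P.map (S t) = uniformOn Set.univ ∨
    P.map (S t) = uniformOn {s | Function.Injective s}

/-- The linear coefficient
`ξ₁ = 1 - η λ_p / λ_{r+1} + η (c K / λ_{r+1}) √(log p / m)`. -/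
def xi₁ (c K η lamP lamR : ℝ) (p m : ℕ) : ℝ :=
  1 - η * (lamP / lamR) + η * (c * K / lamR) * Real.sqrt (Real.log p / m)

end NewSamp

end

/-! For quadratics the Hessians `A i` are constant, so `T = H t ω` depends on the sample `S t`
alone, and the gradient of the objective is `G (θ - θstar)`, `G` being the mean of the `A i`.
Projection onto `C` does not increase the distance to `θstar`. With `x = θ - θstar` and `Q` the
scaling of `T`, the step before projection is `(x - η Q T x) + η Q (T - G) x`. The first term is
diagonal in the eigenbasis of `T` and gives `1 - η λ_p / λ_{r+1}`; the second has norm at most `η ‖T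
- G‖ ‖x‖ / λ_{r+1}` (`norm_proj_step_sub_le`).

It remains to bound `‖T - G‖` by `12 K √(log p / m)` outside an event of probability `1/p`.
Exchangeable pairs give a recursion for even trace moments (`sum_trace_pow_add_two_le`), and
Markov's inequality at order about `2 log p` yields the tail bound (`card_norm_gt_mul_le`). Both
sampling schemes fit the same argument, each with its own involution. -/

namespace NewSamp

/-! ### Trace inequalities for symmetric operators. -/

section Spectral

variable {V : Type*} [NormedAddCommGroup V] [InnerProductSpace ℝ V]

lemma pow_apply_eigenbasis {ι : Type*} [Fintype ι] (b : OrthonormalBasis ι ℝ V) {μ : ι → ℝ}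
    {T : Module.End ℝ V} (hT : ∀ i, T (b i) = μ i • b i) (k : ℕ) (i : ι) :
    (T ^ k) (b i) = μ i ^ k • b i := by
  induction k with
  | zero => simp
  | succ k ih => rw [pow_succ, Module.End.mul_apply, hT, map_smul, ih, smul_smul, pow_succ']

lemma inner_diagonal {ι : Type*} [Fintype ι] (b : OrthonormalBasis ι ℝ V) {μ : ι → ℝ}
    {T : Module.End ℝ V} (hT : ∀ i, T (b i) = μ i • b i) (x y : V) :
    inner ℝ x (T y) = ∑ i, μ i * (inner ℝ x (b i) * inner ℝ (b i) y) := by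
  conv_lhs => rw [← b.sum_repr' y]
  simp only [map_sum, map_smul, hT, inner_sum, inner_smul_right]
  exact Finset.sum_congr rfl fun i _ => by ring

lemma norm_apply_le_of_diagonal {ι : Type*} [Fintype ι] (b : OrthonormalBasis ι ℝ V) {μ : ι → ℝ}
    {T : Module.End ℝ V} (hT : ∀ i, T (b i) = μ i • b i) {c : ℝ} (hc : 0 ≤ c)
    (hμ : ∀ i, |μ i| ≤ c) (x : V) : ‖T x‖ ≤ c * ‖x‖ := by
  have hcoord : ∀ i, inner ℝ (b i) (T x) = μ i * inner ℝ (b i) x := by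
    classical
    intro i
    rw [inner_diagonal b hT, Finset.sum_eq_single i]
    · simp
    · intro j _ hj
      rw [b.inner_eq_ite, if_neg hj.symm]; ring
    · simp
  refine le_of_sq_le_sq ?_ (by positivity)
  rw [mul_pow, ← b.sum_sq_norm_inner_right, ← b.sum_sq_norm_inner_right x, Finset.mul_sum]
  refine Finset.sum_le_sum fun i _ => ?_
  rw [hcoord, norm_mul, mul_pow, Real.norm_eq_abs]
  gcongr
  exact hμ i

lemma trace_pow_eq_sum {ι : Type*} [Fintype ι] [DecidableEq ι] (b : OrthonormalBasis ι ℝ V)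
    {μ : ι → ℝ} {T : Module.End ℝ V} (hT : ∀ i, T (b i) = μ i • b i) (k : ℕ) :
    LinearMap.trace ℝ V (T ^ k) = ∑ i, μ i ^ k := by
  rw [LinearMap.trace_eq_sum_inner _ b]
  refine Finset.sum_congr rfl fun i _ => ?_
  rw [pow_apply_eigenbasis b hT, inner_smul_right, real_inner_self_eq_norm_sq, b.norm_eq_one]
  simp

lemma pow_mul_pow_le_add_pow {N k l : ℕ} (hN : Even N) (hkl : k + l = N) (a b : ℝ) :
    a ^ k * b ^ l ≤ a ^ N + b ^ N := by
  have ha : 0 ≤ a ^ N := hN.pow_nonneg a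
  have hb : 0 ≤ b ^ N := hN.pow_nonneg b
  refine (le_abs_self _).trans ?_
  rw [abs_mul, abs_pow, abs_pow]
  rcases le_total |a| |b| with h | h
  · calc |a| ^ k * |b| ^ l ≤ |b| ^ k * |b| ^ l := by gcongr
      _ = b ^ N := by rw [← pow_add, hkl, hN.pow_abs]
      _ ≤ _ := by linarith
  · calc |a| ^ k * |b| ^ l ≤ |a| ^ k * |a| ^ l := by gcongr
      _ = a ^ N := by rw [← pow_add, hkl, hN.pow_abs]
      _ ≤ _ := by linarith

variable [FiniteDimensional ℝ V]

/-- A crude form of the geometric-arithmetic mean inequality for traces. -/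
lemma trace_mul_pow_mul_pow_le {W Y D : Module.End ℝ V} (hW : W.IsSymmetric) (hY : Y.IsSymmetric)
    (hD : D.IsSymmetric) {L : ℝ} (hDL : ∀ x, ‖D x‖ ≤ L * ‖x‖) {N k l : ℕ} (hN : Even N)
    (hkl : k + l = N) :
    LinearMap.trace ℝ V (D * W ^ k * D * Y ^ l) ≤
      L ^ 2 * (LinearMap.trace ℝ V (W ^ N) + LinearMap.trace ℝ V (Y ^ N)) := by
  set u := hW.eigenvectorBasis rfl
  set v := hY.eigenvectorBasis rfl
  set a := hW.eigenvalues rfl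
  set b := hY.eigenvalues rfl
  have hu : ∀ i, W (u i) = a i • u i := hW.apply_eigenvectorBasis rfl
  have hv : ∀ i, Y (v i) = b i • v i := hY.apply_eigenvectorBasis rfl
  have hle : ∀ x : V, ‖x‖ = 1 → ‖D x‖ ≤ L := fun x hx => by
    simpa [hx] using hDL x
  calc LinearMap.trace ℝ V (D * W ^ k * D * Y ^ l)
      = ∑ j, ∑ i, a i ^ k * b j ^ l * (inner ℝ (u i) (D (v j))) ^ 2 := by
        rw [LinearMap.trace_eq_sum_inner _ v]
        refine Finset.sum_congr rfl fun j _ => ?_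
        simp only [Module.End.mul_apply]
        rw [pow_apply_eigenbasis v hv, map_smul, map_smul, map_smul, inner_smul_right, ← hD,
          inner_diagonal u (pow_apply_eigenbasis u hu k), Finset.mul_sum]
        refine Finset.sum_congr rfl fun i _ => ?_
        rw [real_inner_comm (u i) (D (v j))]; ring
    -- The weights `⟪u i, D (v j)⟫ ^ 2` are nonnegative, so a scalar inequality suffices. Parseval
    -- then sums them over one index.
    _ ≤ ∑ j, ∑ i, (a i ^ N + b j ^ N) * (inner ℝ (u i) (D (v j))) ^ 2 := by
        gcongr
        exact pow_mul_pow_le_add_pow hN hkl _ _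
    _ = (∑ i, a i ^ N * ‖D (u i)‖ ^ 2) + ∑ j, b j ^ N * ‖D (v j)‖ ^ 2 := by
        simp only [add_mul, Finset.sum_add_distrib]
        congr 1
        · rw [Finset.sum_comm]
          refine Finset.sum_congr rfl fun i _ => ?_
          rw [← Finset.mul_sum, ← v.sum_sq_norm_inner_left]
          congr 1
          refine Finset.sum_congr rfl fun j _ => ?_
          rw [hD, Real.norm_eq_abs, sq_abs]
        · refine Finset.sum_congr rfl fun j _ => ?_
          rw [← Finset.mul_sum, ← u.sum_sq_norm_inner_right]
          simp only [Real.norm_eq_abs, sq_abs]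
    _ ≤ (∑ i, a i ^ N * L ^ 2) + ∑ j, b j ^ N * L ^ 2 := by
        have ha : ∀ i, 0 ≤ a i ^ N := fun i => hN.pow_nonneg _
        have hb : ∀ i, 0 ≤ b i ^ N := fun i => hN.pow_nonneg _
        gcongr with i _ j _
        · exact ha i
        · exact hle _ (u.norm_eq_one i)
        · exact hb j
        · exact hle _ (v.norm_eq_one j)
    _ = _ := by
        rw [trace_pow_eq_sum u hu, trace_pow_eq_sum v hv, ← Finset.sum_mul, ← Finset.sum_mul]
        ring

lemma trace_pow_nonneg {X : Module.End ℝ V} (hX : X.IsSymmetric) {N : ℕ} (hN : Even N) :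
    0 ≤ LinearMap.trace ℝ V (X ^ N) := by
  rw [trace_pow_eq_sum _ (hX.apply_eigenvectorBasis rfl)]
  exact Finset.sum_nonneg fun i _ => hN.pow_nonneg _

/-- For even `N` the trace is a sum of nonnegative terms, so it dominates the `N`-th power of each
eigenvalue. -/
lemma norm_apply_le_of_trace_pow_le {X : Module.End ℝ V} (hX : X.IsSymmetric) {N : ℕ}
    (hN : Even N) (hN0 : N ≠ 0) {t : ℝ} (ht : 0 ≤ t) (h : LinearMap.trace ℝ V (X ^ N) ≤ t ^ N)
    (x : V) : ‖X x‖ ≤ t * ‖x‖ := by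
  rw [trace_pow_eq_sum _ (hX.apply_eigenvectorBasis rfl)] at h
  refine norm_apply_le_of_diagonal _ (hX.apply_eigenvectorBasis rfl) ht (fun i => ?_) x
  refine le_of_pow_le_pow_left₀ hN0 ht ?_
  rw [hN.pow_abs]
  exact (Finset.single_le_sum (f := fun i => hX.eigenvalues rfl i ^ N)
    (fun i _ => hN.pow_nonneg _) (Finset.mem_univ i)).trans h

lemma pow_sub_pow_eq_sum {R : Type*} [Ring R] (x y : R) (N : ℕ) :
    x ^ N - y ^ N = ∑ k ∈ Finset.range N, x ^ k * (x - y) * y ^ (N - 1 - k) := by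
  have h := Finset.sum_range_sub (fun k => x ^ k * y ^ (N - k)) N
  simp only [Nat.sub_self, pow_zero, mul_one, Nat.sub_zero, one_mul] at h
  rw [← h]
  refine Finset.sum_congr rfl fun k hk => ?_
  rw [Finset.mem_range] at hk
  obtain ⟨j, rfl⟩ : ∃ j, N = k + 1 + j := ⟨N - (k + 1), by omega⟩
  have h1 : k + 1 + j - (k + 1) = j := by omega
  have h2 : k + 1 + j - k = j + 1 := by omega
  have h3 : k + 1 + j - 1 - k = j := by omega
  rw [h1, h2, h3, pow_succ, pow_succ' y]
  noncomm_ring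

/-- Telescoping the difference of powers leaves `N + 1` terms `D * W ^ k * D * Y ^ l` with `D = W -
Y` and `k + l = N`. -/
lemma trace_sub_mul_pow_sub_pow_le {W Y : Module.End ℝ V} (hW : W.IsSymmetric)
    (hY : Y.IsSymmetric) {L : ℝ} (hL : ∀ x, ‖(W - Y) x‖ ≤ L * ‖x‖) {N : ℕ} (hN : Even N) :
    LinearMap.trace ℝ V ((W - Y) * (W ^ (N + 1) - Y ^ (N + 1))) ≤
      (N + 1) * (L ^ 2 * (LinearMap.trace ℝ V (W ^ N) + LinearMap.trace ℝ V (Y ^ N))) := by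
  rw [pow_sub_pow_eq_sum, Finset.mul_sum, map_sum]
  refine (Finset.sum_le_card_nsmul _ _
    (L ^ 2 * (LinearMap.trace ℝ V (W ^ N) + LinearMap.trace ℝ V (Y ^ N)))
    fun k hk => ?_).trans_eq ?_
  · rw [Finset.mem_range] at hk
    rw [← mul_assoc, ← mul_assoc]
    exact trace_mul_pow_mul_pow_le hW hY (hW.sub hY) hL hN (by omega)
  · rw [Finset.card_range, nsmul_eq_mul]; push_cast; ring

end Spectral

/-! ### Trace moments and tail bounds by exchangeable pairs. -/

section Exchangeable

variable {V : Type*} [NormedAddCommGroup V] [InnerProductSpace ℝ V] [FiniteDimensional ℝ V]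
  {σ τ : Type*} [Fintype σ] [Fintype τ]

/-- The method of exchangeable pairs for trace moments. The pair is `(X s, X (e (s, t)).1)` for
uniform `(s, t)`; it is exchangeable as `e` is an involution. -/
lemma sum_trace_pow_add_two_le {e : σ × τ → σ × τ} (he : Function.Involutive e)
    {X : σ → Module.End ℝ V} (hX : ∀ s, (X s).IsSymmetric) {κ m L : ℝ} (hκ : 0 < κ)
    (hcard : (Fintype.card τ : ℝ) = m * κ)
    (hdrift : ∀ s, ∑ t, (X s - X (e (s, t)).1) = κ • X s)
    (hL : ∀ s t x, ‖(X s - X (e (s, t)).1) x‖ ≤ L * ‖x‖) {N : ℕ} (hN : Even N) :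
    ∑ s, LinearMap.trace ℝ V (X s ^ (N + 2)) ≤
      m * (N + 1) * L ^ 2 * ∑ s, LinearMap.trace ℝ V (X s ^ N) := by
  have hswap : ∀ g : σ × τ → ℝ, ∑ z, g (e z) = ∑ z, g z := fun g =>
    Equiv.sum_comp he.toPerm g
  have hfst : ∑ z : σ × τ, LinearMap.trace ℝ V (X z.1 ^ N) =
      m * κ * ∑ s, LinearMap.trace ℝ V (X s ^ N) := by
    rw [Fintype.sum_prod_type]
    simp [Finset.mul_sum, hcard]
  have hA : κ * ∑ s, LinearMap.trace ℝ V (X s ^ (N + 2)) =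
      ∑ z : σ × τ, LinearMap.trace ℝ V ((X z.1 - X (e z).1) * X z.1 ^ (N + 1)) := by
    rw [Fintype.sum_prod_type, Finset.mul_sum]
    refine Finset.sum_congr rfl fun s _ => ?_
    simp only
    rw [← map_sum, ← Finset.sum_mul, hdrift, smul_mul_assoc, map_smul, smul_eq_mul, ← pow_succ']
  have hA' : ∑ z : σ × τ, LinearMap.trace ℝ V ((X z.1 - X (e z).1) * X z.1 ^ (N + 1)) =
      ∑ z : σ × τ, LinearMap.trace ℝ V ((X (e z).1 - X z.1) * X (e z).1 ^ (N + 1)) := by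
    rw [← hswap]
    simp only [he _]
  -- Adding `hA` to its image under `e` symmetrizes the sum, so that a difference of powers appears.
  have hsum : 2 * (κ * ∑ s, LinearMap.trace ℝ V (X s ^ (N + 2))) ≤
      2 * (κ * (m * (N + 1) * L ^ 2 * ∑ s, LinearMap.trace ℝ V (X s ^ N))) := by
    calc 2 * (κ * ∑ s, LinearMap.trace ℝ V (X s ^ (N + 2)))
        = ∑ z : σ × τ, LinearMap.trace ℝ V
            ((X z.1 - X (e z).1) * (X z.1 ^ (N + 1) - X (e z).1 ^ (N + 1))) := by
          rw [two_mul, hA]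
          nth_rewrite 2 [hA']
          rw [← Finset.sum_add_distrib]
          refine Finset.sum_congr rfl fun z _ => ?_
          rw [← map_add]
          congr 1
          noncomm_ring
      _ ≤ ∑ z : σ × τ, (N + 1) * (L ^ 2 * (LinearMap.trace ℝ V (X z.1 ^ N) +
            LinearMap.trace ℝ V (X (e z).1 ^ N))) :=
          Finset.sum_le_sum fun z _ =>
            trace_sub_mul_pow_sub_pow_le (hX _) (hX _) (hL z.1 z.2) hN
      _ = _ := by
          rw [← Finset.mul_sum, ← Finset.mul_sum, Finset.sum_add_distrib,
            hswap fun z => LinearMap.trace ℝ V (X z.1 ^ N), hfst]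
          ring
  have h2 := le_of_mul_le_mul_left hsum two_pos
  exact le_of_mul_le_mul_left h2 hκ

/-- The recursion is iterated from `tr (X ^ 0) = dim V`, each factor `2 * j + 1` being bounded by `2
* q`. -/
lemma sum_trace_pow_le {e : σ × τ → σ × τ} (he : Function.Involutive e)
    {X : σ → Module.End ℝ V} (hX : ∀ s, (X s).IsSymmetric) {κ m L : ℝ} (hκ : 0 < κ) (hm : 0 ≤ m)
    (hcard : (Fintype.card τ : ℝ) = m * κ)
    (hdrift : ∀ s, ∑ t, (X s - X (e (s, t)).1) = κ • X s)
    (hL : ∀ s t x, ‖(X s - X (e (s, t)).1) x‖ ≤ L * ‖x‖) (q : ℕ) :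
    ∑ s, LinearMap.trace ℝ V (X s ^ (2 * q)) ≤
      (2 * q * m * L ^ 2) ^ q * (Fintype.card σ * Module.finrank ℝ V) := by
  suffices h : ∀ j ≤ q, ∑ s, LinearMap.trace ℝ V (X s ^ (2 * j)) ≤
      (2 * q * m * L ^ 2) ^ j * (Fintype.card σ * Module.finrank ℝ V) from h q le_rfl
  intro j
  induction j with
  | zero => intro _; simp
  | succ j ih =>
    intro hj
    have hnn : 0 ≤ ∑ s, LinearMap.trace ℝ V (X s ^ (2 * j)) :=
      Finset.sum_nonneg fun s _ => trace_pow_nonneg (hX s) (even_two_mul j)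
    have hjq : ((2 * j : ℕ) : ℝ) + 1 ≤ 2 * q := by
      exact_mod_cast (by omega : 2 * j + 1 ≤ 2 * q)
    calc ∑ s, LinearMap.trace ℝ V (X s ^ (2 * (j + 1)))
        ≤ m * ((2 * j : ℕ) + 1) * L ^ 2 * ∑ s, LinearMap.trace ℝ V (X s ^ (2 * j)) :=
          sum_trace_pow_add_two_le he hX hκ hcard hdrift hL (even_two_mul j)
      _ ≤ m * (2 * q) * L ^ 2 * ((2 * q * m * L ^ 2) ^ j *
            (Fintype.card σ * Module.finrank ℝ V)) := by
          gcongr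
          exact ih (by omega)
      _ = _ := by ring

open Classical in
/-- A matrix Hoeffding bound, by Markov's inequality for trace moments of order `log p`. -/
lemma card_norm_gt_mul_le {e : σ × τ → σ × τ} (he : Function.Involutive e)
    {X : σ → Module.End ℝ V} (hX : ∀ s, (X s).IsSymmetric) {κ m L : ℝ} (hκ : 0 < κ) (hm : 0 < m)
    (hL0 : 0 < L) (hcard : (Fintype.card τ : ℝ) = m * κ)
    (hdrift : ∀ s, ∑ t, (X s - X (e (s, t)).1) = κ • X s)
    (hL : ∀ s t x, ‖(X s - X (e (s, t)).1) x‖ ≤ L * ‖x‖) {p : ℕ} (hp : 3 ≤ p)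
    (hdim : Module.finrank ℝ V = p) :
    ((Finset.univ.filter fun s =>
        ¬ ∀ x, ‖X s x‖ ≤ 6 * L * √(m * Real.log p) * ‖x‖).card : ℝ) * p ≤ Fintype.card σ := by
  set t := 6 * L * √(m * Real.log p) with ht
  set bad := Finset.univ.filter fun s => ¬ ∀ x, ‖X s x‖ ≤ t * ‖x‖
  have hp3 : (3 : ℝ) ≤ p := by exact_mod_cast hp
  have hp0 : (0 : ℝ) < p := by linarith
  -- This is where `3 ≤ p` enters: rounding `log p` up then at most doubles it.
  have hlog : 1 ≤ Real.log p := by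
    rw [Real.le_log_iff_exp_le hp0]
    have := Real.exp_one_lt_d9
    linarith
  have ht0 : 0 < t := by positivity
  have htsq : t ^ 2 = 36 * L ^ 2 * (m * Real.log p) := by
    rw [ht, mul_pow, Real.sq_sqrt (by positivity)]; ring
  set q := ⌈Real.log p⌉₊ with hq
  have hq1 : Real.log p ≤ q := Nat.le_ceil _
  have hq2 : (q : ℝ) ≤ 2 * Real.log p := by
    have := (Nat.ceil_lt_add_one (by linarith : 0 ≤ Real.log p)).le
    linarith
  have hq0 : 2 * q ≠ 0 := by
    have : 0 < q := Nat.ceil_pos.2 (by linarith)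
    omega
  have hmarkov : (bad.card : ℝ) * t ^ (2 * q) ≤ ∑ s, LinearMap.trace ℝ V (X s ^ (2 * q)) := by
    rw [← nsmul_eq_mul]
    refine (Finset.card_nsmul_le_sum bad _ _ fun s hs => ?_).trans
      (Finset.sum_le_sum_of_subset_of_nonneg (Finset.subset_univ _) fun s _ _ =>
        trace_pow_nonneg (hX s) (even_two_mul q))
    by_contra hlt
    exact (Finset.mem_filter.1 hs).2
      (norm_apply_le_of_trace_pow_le (hX s) (even_two_mul q) hq0 ht0.le (not_le.1 hlt).le)
  -- The constant 6 makes this ratio `4 / 36 = 1 / 9`. As `9 > e ^ 2`, the factor `9 ^ q` exceeds `p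
  -- ^ 2`, absorbing the dimension and leaving `1 / p`.
  have hbase : 2 * q * m * L ^ 2 ≤ t ^ 2 / 9 := by
    rw [htsq]
    calc 2 * q * m * L ^ 2 ≤ 2 * (2 * Real.log p) * m * L ^ 2 := by gcongr
      _ = _ := by ring
  have hmom := hmarkov.trans (sum_trace_pow_le he hX hκ hm.le hcard hdrift hL q)
  have hpow : (2 * q * m * L ^ 2) ^ q ≤ t ^ (2 * q) / 9 ^ q := by
    rw [pow_mul, ← div_pow]; gcongr
  have h9 : (p : ℝ) ^ 2 ≤ 9 ^ q := by
    calc (p : ℝ) ^ 2 = Real.exp (Real.log p) ^ 2 := by rw [Real.exp_log hp0]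
      _ ≤ Real.exp q ^ 2 := by gcongr
      _ = (Real.exp 1 ^ 2) ^ q := by
        rw [← Real.exp_nat_mul, ← Real.exp_nat_mul, ← Real.exp_nat_mul]; congr 1; push_cast; ring
      _ ≤ 9 ^ q := by
        gcongr
        have h1 := Real.exp_one_lt_d9
        have h2 := Real.exp_pos 1
        nlinarith
  rw [hdim] at hmom
  have hfin : (bad.card : ℝ) * t ^ (2 * q) ≤
      t ^ (2 * q) * (Fintype.card σ * p / 9 ^ q) := by
    refine hmom.trans ((mul_le_mul_of_nonneg_right hpow (by positivity)).trans_eq (by ring))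
  rw [mul_comm] at hfin
  have hb := le_of_mul_le_mul_left hfin (by positivity)
  calc (bad.card : ℝ) * p ≤ Fintype.card σ * p / 9 ^ q * p := by gcongr
    _ = Fintype.card σ * (p ^ 2 / 9 ^ q) := by ring
    _ ≤ Fintype.card σ * 1 := by
        gcongr
        rw [div_le_one (by positivity)]
        exact h9
    _ = _ := mul_one _

end Exchangeable

/-! ### Sampling with and without replacement. -/

section Sampling

lemma sum_update_comp {M : Type*} [AddCommGroup M] {m n : ℕ} (B : Fin n → M) (s : Fin m → Fin n)
    (j : Fin m) (i : Fin n) :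
    ∑ k, B (s k) - ∑ k, B (Function.update s j i k) = B (s j) - B i := by
  rw [← Finset.sum_sub_distrib, Finset.sum_eq_single j]
  · simp
  · intro k _ hk
    simp [Function.update_of_ne hk]
  · simp

lemma sum_swap_comp_of_notMem {M : Type*} [AddCommGroup M] {m n : ℕ} (B : Fin n → M)
    {s : Fin m → Fin n} (hs : Function.Injective s) (j : Fin m) {i : Fin n} (hi : ∀ k, s k ≠ i) :
    ∑ k, B (s k) - ∑ k, B (Equiv.swap (s j) i (s k)) = B (s j) - B i := by
  rw [← sum_update_comp B s j i]
  congr 1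
  refine Finset.sum_congr rfl fun k _ => ?_
  rcases eq_or_ne k j with rfl | hk
  · simp
  · rw [Function.update_of_ne hk, Equiv.swap_apply_of_ne_of_ne (hs.ne hk) (hi k)]

lemma sum_swap_comp_of_mem {M : Type*} [AddCommGroup M] {m n : ℕ} (B : Fin n → M)
    {s : Fin m → Fin n} (hs : Function.Injective s) (j k : Fin m) :
    ∑ l, B (s l) - ∑ l, B (Equiv.swap (s j) (s k) (s l)) = 0 := by
  simp only [← hs.map_swap]
  rw [Equiv.sum_comp (Equiv.swap j k) fun l => B (s l), sub_self]

/-- Indices `i` already in the sample contribute zero. Completing the sum to all `i` adds the terms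
`B (s j) - B (s k)`, which cancel by antisymmetry in `j` and `k`. -/
lemma sum_sum_swap_comp {M : Type*} [AddCommGroup M] {m n : ℕ} {B : Fin n → M}
    (hB : ∑ i, B i = 0) {s : Fin m → Fin n} (hs : Function.Injective s) :
    ∑ j, ∑ i, (∑ k, B (s k) - ∑ k, B (Equiv.swap (s j) i (s k))) = n • ∑ k, B (s k) := by
  have hj : ∀ j, ∑ i, (∑ k, B (s k) - ∑ k, B (Equiv.swap (s j) i (s k))) =
      ∑ i, (B (s j) - B i) - ∑ k, (B (s j) - B (s k)) := by
    intro j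
    have himg : ∑ k, (B (s j) - B (s k)) =
        ∑ i ∈ Finset.univ.map ⟨s, hs⟩, (B (s j) - B i) := by
      rw [Finset.sum_map]; rfl
    rw [himg, ← Finset.sum_compl_add_sum (Finset.univ.map ⟨s, hs⟩) fun i => B (s j) - B i,
      add_sub_cancel_right, ← Finset.sum_compl_add_sum (Finset.univ.map ⟨s, hs⟩)]
    rw [Finset.sum_eq_zero (s := Finset.univ.map ⟨s, hs⟩), add_zero]
    · refine Finset.sum_congr rfl fun i hi => sum_swap_comp_of_notMem B hs j fun k hk => ?_
      exact (Finset.mem_compl.1 hi) (Finset.mem_map.2 ⟨k, Finset.mem_univ _, hk⟩)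
    · intro i hi
      obtain ⟨k, -, rfl⟩ := Finset.mem_map.1 hi
      exact sum_swap_comp_of_mem B hs j k
  simp only [hj, Finset.sum_sub_distrib, hB]
  simp [Finset.smul_sum]

variable {V : Type*} [NormedAddCommGroup V] [InnerProductSpace ℝ V] [FiniteDimensional ℝ V]
  {m n p : ℕ} {B : Fin n → Module.End ℝ V} {L : ℝ}

open Classical in
lemma card_norm_gt_mul_le_of_replacement (hB : ∀ i, (B i).IsSymmetric) (hsum : ∑ i, B i = 0)
    (hm : 0 < m) (hn : 0 < n) (hL0 : 0 < L) (hL : ∀ i k x, ‖(B i - B k) x‖ ≤ L * ‖x‖) (hp : 3 ≤ p)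
    (hdim : Module.finrank ℝ V = p) :
    ((Finset.univ.filter fun s : Fin m → Fin n =>
        ¬ ∀ x, ‖(∑ j, B (s j)) x‖ ≤ 6 * L * √(m * Real.log p) * ‖x‖).card : ℝ) * p ≤
      Fintype.card (Fin m → Fin n) := by
  have hm' : (0 : ℝ) < m := by exact_mod_cast hm
  have hn' : (0 : ℝ) < n := by exact_mod_cast hn
  refine card_norm_gt_mul_le (τ := Fin m × Fin n) (κ := n)
    -- Entry `j` is resampled; the old entry is kept in the last slot, so that a second application
    -- restores it.
    (e := fun z => (Function.update z.1 z.2.1 z.2.2, z.2.1, z.1 z.2.1))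
    (X := fun s : Fin m → Fin n => ∑ j, B (s j))
    (fun z => ?_) (fun s => ?_) hn' hm' hL0 (by simp) (fun s => ?_) (fun s t x => ?_) hp hdim
  · simp
  · exact LinearMap.isSymmetric_sum _ fun j _ => hB _
  · simp only [sum_update_comp]
    rw [Fintype.sum_prod_type]
    simp only [Finset.sum_sub_distrib, hsum]
    simp [Finset.smul_sum, Nat.cast_smul_eq_nsmul]
  · simp only [sum_update_comp]
    exact hL _ _ _

open Classical in
lemma card_norm_gt_mul_le_of_injective (hB : ∀ i, (B i).IsSymmetric) (hsum : ∑ i, B i = 0)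
    (hm : 0 < m) (hn : 0 < n) (hL0 : 0 < L) (hL : ∀ i k x, ‖(B i - B k) x‖ ≤ L * ‖x‖) (hp : 3 ≤ p)
    (hdim : Module.finrank ℝ V = p) :
    ((Finset.univ.filter fun s : {s : Fin m → Fin n // Function.Injective s} =>
        ¬ ∀ x, ‖(∑ j, B (s.1 j)) x‖ ≤ 6 * L * √(m * Real.log p) * ‖x‖).card : ℝ) * p ≤
      Fintype.card {s : Fin m → Fin n // Function.Injective s} := by
  have hm' : (0 : ℝ) < m := by exact_mod_cast hm
  have hn' : (0 : ℝ) < n := by exact_mod_cast hn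
  refine card_norm_gt_mul_le (τ := Fin m × Fin n) (κ := n)
    -- Swapping the values `s j` and `i` keeps the list injective, even when `i` is already sampled.
    (e := fun z => (⟨fun k => Equiv.swap (z.1.1 z.2.1) z.2.2 (z.1.1 k),
      (Equiv.injective _).comp z.1.2⟩, z.2.1, z.1.1 z.2.1))
    (X := fun s : {s : Fin m → Fin n // Function.Injective s} => ∑ j, B (s.1 j))
    (fun z => ?_) (fun s => ?_) hn' hm' hL0 (by simp) (fun s => ?_) (fun s t x => ?_) hp hdim
  · ext k
    · simp [Equiv.swap_comm z.2.2]
    · simp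
    · simp
  · exact LinearMap.isSymmetric_sum _ fun j _ => hB _
  · rw [Fintype.sum_prod_type, Nat.cast_smul_eq_nsmul]
    exact sum_sum_swap_comp hsum s.2
  · by_cases h : ∃ k, s.1 k = t.2
    · obtain ⟨k, hk⟩ := h
      simp only [← hk, sum_swap_comp_of_mem B s.2]
      simp only [LinearMap.zero_apply, norm_zero]
      positivity
    · push Not at h
      simp only [sum_swap_comp_of_notMem B s.2 t.1 h]
      exact hL _ _ _

lemma uniformOn_real_le {α : Type*} [Fintype α] [MeasurableSpace α] [MeasurableSingletonClass α]
    {s : Set α} (q : α → Prop) [DecidablePred q] [Fintype s] {p : ℝ} (hp : 0 < p)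
    (h : ((Finset.univ.filter fun a : s => q a).card : ℝ) * p ≤ Fintype.card s) :
    (uniformOn s).real {a | q a} ≤ 1 / p := by
  classical
  have h1 : (uniformOn s).real {a | q a} =
      ((s.toFinset ∩ Finset.univ.filter q).card : ℝ) / s.toFinset.card := by
    have := uniformOn_apply_finset (s := s.toFinset) (t := Finset.univ.filter q)
    simp only [Set.coe_toFinset, Finset.coe_filter, Finset.mem_univ, true_and] at this
    rw [measureReal_def, this]
    simp
  have h2 : (s.toFinset ∩ Finset.univ.filter q).card =
      (Finset.univ.filter fun a : s => q a).card := by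
    rw [← Finset.card_map (Function.Embedding.subtype _)]
    congr 1
    ext a
    simp [and_comm]
  rw [h1, h2, Set.toFinset_card]
  -- An empty `s` is allowed: the quotient is then `0 / 0 = 0`.
  refine div_le_of_le_mul₀ (by positivity) (by positivity) ?_
  rw [one_div, mul_comm, ← div_eq_mul_inv, le_div_iff₀ hp]
  exact h

end Sampling

/-! ### One projected step for a fixed sample. -/

section Deterministic

variable {p : ℕ}

lemma hasGradientAt_of_eq_quadratic {g : E p → ℝ} {A : E p →L[ℝ] E p} {b : E p} {d : ℝ}
    (hA : (A : E p →ₗ[ℝ] E p).IsSymmetric)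
    (hg : ∀ θ, g θ = (1 / 2) * inner ℝ θ (A θ) + inner ℝ b θ + d) (θ : E p) :
    HasGradientAt g (A θ + b) θ := by
  rw [hasGradientAt_iff_hasFDerivAt, show g = _ from funext hg]
  have h1 : HasFDerivAt (fun θ : E p => inner ℝ θ (A θ)) _ θ :=
    (hasFDerivAt_id θ).inner ℝ A.hasFDerivAt
  have h2 : HasFDerivAt (fun θ : E p => inner ℝ b θ) _ θ := (innerSL ℝ b).hasFDerivAt
  refine (((h1.const_mul (1 / 2)).add h2).add_const d).congr_fderiv ?_
  ext v
  have hs : inner ℝ (A θ) v = inner ℝ θ (A v) := hA θ v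
  simp [hs, fderivInnerCLM_apply]
  rw [← hs, real_inner_comm]
  ring

lemma hessian_of_gradient_eq {g : E p → ℝ} {A : E p →L[ℝ] E p} {b : E p}
    (hg : ∀ θ, HasGradientAt g (A θ + b) θ) (θ : E p) : hessian g θ = A := by
  rw [hessian, gradient_eq hg]
  exact (A.hasFDerivAt.add_const b).fderiv

/-- Stationarity at `θstar` removes the linear terms. -/
lemma gradient_objective {n : ℕ} {f : Fin n → E p → ℝ} {A : Fin n → E p →L[ℝ] E p}
    {b : Fin n → E p} (hf : ∀ i θ, HasGradientAt (f i) (A i θ + b i) θ) {θstar : E p}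
    (hmin : ∀ θ, objective f θstar ≤ objective f θ) (θ : E p) :
    gradient (objective f) θ = ((n : ℝ)⁻¹ • ∑ i, A i) (θ - θstar) := by
  have hgrad : ∀ θ, HasGradientAt (objective f) ((n : ℝ)⁻¹ • ∑ i, (A i θ + b i)) θ := by
    intro θ
    rw [hasGradientAt_iff_hasFDerivAt]
    refine ((HasFDerivAt.fun_sum fun i (_ : i ∈ Finset.univ) =>
      (hf i θ).hasFDerivAt).const_mul (n : ℝ)⁻¹).congr_fderiv ?_
    simp
  have hzero : (n : ℝ)⁻¹ • ∑ i, (A i θstar + b i) = 0 := by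
    have hloc : IsLocalMin (objective f) θstar := Filter.Eventually.of_forall hmin
    have := hloc.hasFDerivAt_eq_zero (hgrad θstar).hasFDerivAt
    have h2 := (InnerProductSpace.toDual ℝ (E p)).map_eq_zero_iff.1 this
    exact h2
  rw [(hgrad θ).gradient, ← sub_zero ((n : ℝ)⁻¹ • _), ← hzero, ← smul_sub,
    ← Finset.sum_sub_distrib]
  simp

lemma norm_proj_sub_le {C : Set (E p)} (hC : Convex ℝ C) (hcl : IsClosed C) {c : E p} (hc : c ∈ C)
    (x : E p) : ‖proj C x - c‖ ≤ ‖x - c‖ := by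
  have hex : ∃ y, y ∈ C ∧ ∀ z ∈ C, ‖x - y‖ ≤ ‖x - z‖ := by
    obtain ⟨y, hy, hyx⟩ := hcl.exists_infDist_eq_dist ⟨c, hc⟩ x
    refine ⟨y, hy, fun z hz => ?_⟩
    rw [← dist_eq_norm, ← dist_eq_norm, ← hyx]
    exact Metric.infDist_le_dist_of_mem hz
  obtain ⟨hyC, hy⟩ : proj C x ∈ C ∧ ∀ z ∈ C, ‖x - proj C x‖ ≤ ‖x - z‖ :=
    Classical.epsilon_spec hex
  set y := proj C x
  have : Nonempty C := ⟨⟨c, hc⟩⟩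
  have hinf : ‖x - y‖ = ⨅ w : C, ‖x - w‖ :=
    le_antisymm (le_ciInf fun w => hy w w.2)
      (ciInf_le ⟨0, by rintro _ ⟨w, rfl⟩; exact norm_nonneg _⟩ (⟨y, hyC⟩ : C))
  -- The variational inequality: `x - y` makes a non-acute angle with `c - y`.
  have hin := (norm_eq_iInf_iff_real_inner_le_zero hC hyC).1 hinf c hc
  refine le_of_sq_le_sq ?_ (norm_nonneg _)
  have hexp : ‖x - c‖ ^ 2 = ‖x - y‖ ^ 2 - 2 * inner ℝ (x - y) (c - y) + ‖y - c‖ ^ 2 := by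
    rw [norm_sub_rev y c, ← norm_sub_sq_real]
    congr 2
    abel
  nlinarith [sq_nonneg ‖x - y‖]

variable {T : E p →L[ℝ] E p}

lemma lam_antitone (hT : (T : E p →ₗ[ℝ] E p).IsSymmetric) : Antitone (lam T) := by
  have : lam T = hT.eigenvalues finrank_euclideanSpace_fin := funext fun i => by rw [lam, dif_pos hT]
  rw [this]
  exact hT.eigenvalues_antitone _

lemma exists_orthonormalBasis_eigvec (hT : (T : E p →ₗ[ℝ] E p).IsSymmetric) :
    ∃ b : OrthonormalBasis (Fin p) ℝ (E p), ∀ i, b i = eigvec T i ∧ T (b i) = lam T i • b i := by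
  refine ⟨hT.eigenvectorBasis finrank_euclideanSpace_fin, fun i => ?_⟩
  rw [eigvec, lam, dif_pos hT, dif_pos hT]
  exact ⟨rfl, hT.apply_eigenvectorBasis _ i⟩

lemma scaling_apply_of_eigvec {b : OrthonormalBasis (Fin p) ℝ (E p)} (hb : ∀ i, b i = eigvec T i)
    (r i : Fin p) :
    scaling r T (b i) = (if i < r then (lam T i)⁻¹ else (lam T r)⁻¹) • b i := by
  have hsum : ∑ j ∈ Finset.Iio r, ((lam T j)⁻¹ - (lam T r)⁻¹) • (inner ℝ (b j) (b i) • b j) =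
      if i < r then ((lam T i)⁻¹ - (lam T r)⁻¹) • b i else 0 := by
    simp only [b.inner_eq_ite, ite_smul, smul_ite, one_smul, zero_smul, smul_zero]
    rw [Finset.sum_ite_eq']
    simp
  have happ : scaling r T (b i) = (lam T r)⁻¹ • b i +
      ∑ j ∈ Finset.Iio r, ((lam T j)⁻¹ - (lam T r)⁻¹) • (inner ℝ (b j) (b i) • b j) := by
    simp [scaling, hb]
  rw [happ, hsum]
  split_ifs
  · rw [← add_smul, add_sub_cancel]
  · rw [add_zero]

variable {r : Fin p} {η : ℝ}

lemma norm_scaling_apply_le (hT : (T : E p →ₗ[ℝ] E p).IsSymmetric) (hr : 0 < lam T r) (x : E p) :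
    ‖scaling r T x‖ ≤ (lam T r)⁻¹ * ‖x‖ := by
  obtain ⟨b, hb⟩ := exists_orthonormalBasis_eigvec hT
  refine norm_apply_le_of_diagonal b (T := (scaling r T : E p →ₗ[ℝ] E p))
    (scaling_apply_of_eigvec (fun i => (hb i).1) r) (by positivity) (fun i => ?_) x
  split_ifs with h
  · have := lam_antitone hT h.le
    rw [abs_of_pos (inv_pos.2 (hr.trans_le this))]
    gcongr
  · rw [abs_of_pos (inv_pos.2 hr)]

lemma norm_sub_smul_scaling_apply_le (hT : (T : E p →ₗ[ℝ] E p).IsSymmetric) (hr : 0 < lam T r)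
    (hη : 0 ≤ η) (hη' : η ≤ 2 / (1 + lamMin r.pos T / lam T r)) (x : E p) :
    ‖x - η • scaling r T (T x)‖ ≤ (1 - η * (lamMin r.pos T / lam T r)) * ‖x‖ := by
  obtain ⟨b, hb⟩ := exists_orthonormalBasis_eigvec hT
  set ρ := lamMin r.pos T / lam T r with hρ
  have hmin : ∀ i, lamMin r.pos T ≤ lam T i := fun i =>
    lam_antitone hT (Fin.le_def.2 (by simp only; omega))
  have hρ1 : ρ ≤ 1 := (div_le_one hr).2 (hmin r)
  -- The eigenvalues of `R` are `1 - η * w` with `ρ ≤ w ≤ 1`. The bound `η * w - 1 ≤ 1 - η * ρ` is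
  -- tightest at `w = 1`, where it is this inequality. `ρ` may be negative.
  have hkey : η * (1 + ρ) ≤ 2 := by
    rcases lt_or_ge 0 (1 + ρ) with h | h
    · exact (le_div_iff₀ h).1 hη'
    · nlinarith
  let R : E p →L[ℝ] E p := ContinuousLinearMap.id ℝ (E p) - η • (scaling r T ∘L T)
  have hR : ∀ x, R x = x - η • scaling r T (T x) := fun _ => rfl
  have hdiag : ∀ i, R (b i) = (1 - η * (if i < r then 1 else lam T i / lam T r)) • b i := by
    intro i
    rw [hR, (hb i).2, map_smul, scaling_apply_of_eigvec (fun i => (hb i).1)]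
    rw [sub_smul, one_smul, mul_smul, smul_smul (lam T i)]
    congr 3
    split_ifs with h
    · exact mul_inv_cancel₀ (hr.trans_le (lam_antitone hT h.le)).ne'
    · rfl
  have hbd : ∀ i, ρ ≤ (if i < r then 1 else lam T i / lam T r) ∧
      (if i < r then 1 else lam T i / lam T r) ≤ 1 := by
    intro i
    split_ifs with h
    · exact ⟨hρ1, le_rfl⟩
    · exact ⟨div_le_div_of_nonneg_right (hmin i) hr.le,
        (div_le_one hr).2 (lam_antitone hT (not_lt.1 h))⟩
  have hnn : 0 ≤ 1 - η * ρ := by nlinarith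
  rw [← hR]
  refine norm_apply_le_of_diagonal b (T := (R : E p →ₗ[ℝ] E p)) hdiag hnn (fun i => ?_) x
  obtain ⟨h1, h2⟩ := hbd i
  rw [abs_le]
  constructor <;> nlinarith

/-- One projected step with the scaling of `T`, when the gradient is `G (θ - θstar)`. -/
lemma norm_proj_step_sub_le {C : Set (E p)} (hC : Convex ℝ C) (hcl : IsClosed C) {θstar : E p}
    (hstar : θstar ∈ C) (hT : (T : E p →ₗ[ℝ] E p).IsSymmetric) (hr : 0 < lam T r)
    (hη : 0 ≤ η) (hη' : η ≤ 2 / (1 + lamMin r.pos T / lam T r)) {G : E p →L[ℝ] E p} {δ : ℝ}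
    (hδ : ∀ x, ‖(T - G) x‖ ≤ δ * ‖x‖) (θ : E p) :
    ‖proj C (θ - η • scaling r T (G (θ - θstar))) - θstar‖ ≤
      (1 - η * (lamMin r.pos T / lam T r) + η * (δ / lam T r)) * ‖θ - θstar‖ := by
  refine (norm_proj_sub_le hC hcl hstar _).trans ?_
  set x := θ - θstar with hx
  have hsplit : θ - η • scaling r T (G x) - θstar =
      (x - η • scaling r T (T x)) + η • scaling r T ((T - G) x) := by
    have : (T - G) x = T x - G x := rfl
    rw [this, (scaling r T).map_sub (T x), smul_sub, hx]
    abel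
  rw [hsplit, add_mul]
  refine (norm_add_le _ _).trans
    (add_le_add (norm_sub_smul_scaling_apply_le hT hr hη hη' x) ?_)
  rw [norm_smul, Real.norm_of_nonneg hη, mul_assoc]
  gcongr
  calc ‖scaling r T ((T - G) x)‖ ≤ (lam T r)⁻¹ * ‖(T - G) x‖ := norm_scaling_apply_le hT hr _
    _ ≤ (lam T r)⁻¹ * (δ * ‖x‖) := by gcongr; exact hδ x
    _ = _ := by ring

end Deterministic

/-! ### Concentration of the sub-sampled Hessian. -/

section Concentration

variable {p n m : ℕ}

/-- The mean of a sub-sample of symmetric matrices concentrates around the mean of all of them. -/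
lemma uniformOn_norm_sampleMean_sub_mean_gt_le {A : Fin n → E p →L[ℝ] E p} {K : ℝ}
    (hA : ∀ i, (A i : E p →ₗ[ℝ] E p).IsSymmetric) (hK : ∀ i, ‖A i‖ ≤ K) (hm : 0 < m) (hn : 0 < n)
    (hp : 3 ≤ p) {μ : Measure (Fin m → Fin n)}
    (hμ : μ = uniformOn Set.univ ∨ μ = uniformOn {s | Function.Injective s}) :
    μ.real {s | ¬ ∀ x, ‖((m : ℝ)⁻¹ • ∑ j, A (s j) - (n : ℝ)⁻¹ • ∑ i, A i) x‖ ≤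
      12 * K * √(Real.log p / m) * ‖x‖} ≤ 1 / p := by
  classical
  have hm' : (0 : ℝ) < m := by exact_mod_cast hm
  have hn' : (0 : ℝ) < n := by exact_mod_cast hn
  have hp' : (0 : ℝ) < p := by exact_mod_cast (by omega : 0 < p)
  have hK0 : 0 ≤ K := (norm_nonneg _).trans (hK ⟨0, hn⟩)
  -- The tail bound needs `L = 2 * K` positive; if `K = 0`, all matrices vanish.
  rcases hK0.eq_or_lt with rfl | hKpos
  · have hzero : ∀ i, A i = 0 := fun i => norm_le_zero_iff.1 (hK i)
    simp [hzero]
  set B : Fin n → Module.End ℝ (E p) := fun i =>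
    (A i : E p →ₗ[ℝ] E p) - (n : ℝ)⁻¹ • ∑ k, (A k : E p →ₗ[ℝ] E p) with hBdef
  have hB : ∀ i, (B i).IsSymmetric := fun i =>
    (hA i).sub ((LinearMap.isSymmetric_sum _ fun k _ => hA k).smul (by simp))
  have hsum : ∑ i, B i = 0 := by
    simp only [hBdef, Finset.sum_sub_distrib, Finset.sum_const, Finset.card_univ, Fintype.card_fin]
    rw [← Nat.cast_smul_eq_nsmul ℝ, smul_smul, mul_inv_cancel₀ hn'.ne', one_smul, sub_self]
  have hL : ∀ i k x, ‖(B i - B k) x‖ ≤ 2 * K * ‖x‖ := by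
    intro i k x
    have h1 : (B i - B k) x = A i x - A k x := by simp [hBdef]
    rw [h1]
    calc ‖A i x - A k x‖ ≤ ‖A i x‖ + ‖A k x‖ := norm_sub_le _ _
      _ ≤ K * ‖x‖ + K * ‖x‖ := add_le_add ((A i).le_of_opNorm_le (hK i) x)
          ((A k).le_of_opNorm_le (hK k) x)
      _ = _ := by ring
  have hsqrt : √(m * Real.log p) = m * √(Real.log p / m) := by
    rw [show (m : ℝ) * Real.log p = m ^ 2 * (Real.log p / m) by field_simp,
      Real.sqrt_mul (by positivity), Real.sqrt_sq hm'.le]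
  have hset : ∀ s : Fin m → Fin n,
      (¬ ∀ x, ‖((m : ℝ)⁻¹ • ∑ j, A (s j) - (n : ℝ)⁻¹ • ∑ i, A i) x‖ ≤
        12 * K * √(Real.log p / m) * ‖x‖) ↔
      ¬ ∀ x, ‖(∑ j, B (s j)) x‖ ≤ 6 * (2 * K) * √(m * Real.log p) * ‖x‖ := by
    intro s
    refine not_congr (forall_congr' fun x => ?_)
    have h1 : ((m : ℝ)⁻¹ • ∑ j, A (s j) - (n : ℝ)⁻¹ • ∑ i, A i) x =
        (m : ℝ)⁻¹ • (∑ j, B (s j)) x := by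
      have h2 : ∑ j, B (s j) = ∑ j, (A (s j) : E p →ₗ[ℝ] E p) -
          (m : ℝ) • (n : ℝ)⁻¹ • ∑ k, (A k : E p →ₗ[ℝ] E p) := by
        simp [hBdef, Nat.cast_smul_eq_nsmul]
      rw [h2]
      simp only [LinearMap.sub_apply, LinearMap.smul_apply, LinearMap.sum_apply, smul_sub,
        smul_smul _ (m : ℝ), inv_mul_cancel₀ hm'.ne', one_smul]
      simp
    rw [h1, norm_smul, norm_inv, Real.norm_of_nonneg hm'.le, inv_mul_le_iff₀ hm', hsqrt]
    ring_nf
  simp only [hset]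
  have hdim : Module.finrank ℝ (E p) = p := finrank_euclideanSpace_fin
  have hL0 : 0 < 2 * K := by positivity
  rcases hμ with rfl | rfl
  · refine uniformOn_real_le _ hp' ?_
    have h := card_norm_gt_mul_le_of_replacement hB hsum hm hn hL0 hL hp hdim
    rw [Fintype.card_congr (Equiv.Set.univ (Fin m → Fin n))]
    convert h using 3
    refine Finset.card_bij (fun s _ => s.1) ?_ ?_ ?_
    · intro s hs; simpa using hs
    · intro s _ s' _ h; exact Subtype.ext h
    · intro s hs; exact ⟨⟨s, trivial⟩, by simpa using hs, rfl⟩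
  · exact uniformOn_real_le _ hp'
      (card_norm_gt_mul_le_of_injective hB hsum hm hn hL0 hL hp hdim)

end Concentration

end NewSamp

/-! ### The main theorem. -/

theorem corollary1 :
    ∃ c : ℝ, 0 < c ∧
      ∀ (p n : ℕ) (r : Fin p) (f : Fin n → NewSamp.E p → ℝ) (C : Set (NewSamp.E p)) (K : ℝ)
        (θ₀ θstar : NewSamp.E p) (m : ℕ → ℕ)
        (Ω : Type*) [MeasurableSpace Ω] (P : Measure Ω) [IsProbabilityMeasure P]
        (S : ∀ t, Ω → Fin (m t) → Fin n) (η : ℕ → Ω → ℝ),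
        (∀ i, NewSamp.IsQuadratic (f i)) →
        Convex ℝ C → IsClosed C →
        (∀ i, ∀ θ ∈ C, ‖NewSamp.hessian (f i) θ‖ ≤ K) →
        (∀ θ, NewSamp.objective f θstar ≤ NewSamp.objective f θ) → θstar ∈ C →
        (∀ t, 0 < m t) → NewSamp.IsIndependentSubsampling P S →
        (∀ t, Measurable (η t)) →
        let θ : ℕ → Ω → NewSamp.E p := fun t ω =>
          NewSamp.iterate f C r θ₀ (fun τ => η τ ω) (fun τ => S τ ω) t
        let H : ℕ → Ω → NewSamp.E p →L[ℝ] NewSamp.E p := fun t ω =>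
          NewSamp.subHessian f (S t ω) (θ t ω)
        let lamR : ℕ → Ω → ℝ := fun t ω => NewSamp.lam (H t ω) r
        let lamP : ℕ → Ω → ℝ := fun t ω => NewSamp.lamMin r.pos (H t ω)
        ∀ t : ℕ,
          (∀ᵐ ω ∂P, 0 < lamR t ω →
            0 ≤ η t ω ∧ η t ω ≤ 2 / (1 + lamP t ω / lamR t ω)) →
          1 - 2 / (p : ℝ) ≤ P.real {ω | 0 < lamR t ω →
            ‖θ (t + 1) ω - θstar‖ ≤
              NewSamp.xi₁ c K (η t ω) (lamP t ω) (lamR t ω) p (m t) * ‖θ t ω - θstar‖} := by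
  refine ⟨12, by norm_num, ?_⟩
  intro p n r f C K θ₀ θstar m Ω _ P _ S η hf hC hcl hK hmin hstar hm hS _ θ H lamR lamP t hη
  have hp0 : (0 : ℝ) < p := by exact_mod_cast r.pos
  -- For `p ≤ 2` the claimed probability is at most zero.
  rcases lt_or_ge p 3 with hp | hp
  · have hp2 : (p : ℝ) ≤ 2 := by exact_mod_cast (by omega : p ≤ 2)
    have : 1 ≤ 2 / (p : ℝ) := (one_le_div hp0).2 hp2
    exact (by linarith : 1 - 2 / (p : ℝ) ≤ 0).trans measureReal_nonneg
  choose A b d hA hfA using hf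
  have hgrad : ∀ i θ, HasGradientAt (f i) (A i θ + b i) θ := fun i =>
    NewSamp.hasGradientAt_of_eq_quadratic (hA i) (hfA i)
  have hhess : ∀ i θ, NewSamp.hessian (f i) θ = A i := fun i =>
    NewSamp.hessian_of_gradient_eq (hgrad i)
  have hKA : ∀ i, ‖A i‖ ≤ K := fun i => hhess i θstar ▸ hK i θstar hstar
  have hn : 0 < n := by
    obtain ⟨ω⟩ : Nonempty Ω := nonempty_of_isProbabilityMeasure P
    exact (S t ω ⟨0, hm t⟩).pos
  have hH : ∀ ω, H t ω = ((m t : ℝ)⁻¹ • ∑ j, A (S t ω j)) := fun ω => by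
    simp only [H, NewSamp.subHessian, hhess]
  have hHsymm : ∀ ω, (H t ω : NewSamp.E p →ₗ[ℝ] NewSamp.E p).IsSymmetric := fun ω => by
    have h := (LinearMap.isSymmetric_sum Finset.univ fun j _ => hA (S t ω j)).smul
      (c := (m t : ℝ)⁻¹) (by simp)
    rw [hH]
    simpa using h
  set bad : Set (Fin (m t) → Fin n) := {s | ¬ ∀ x,
    ‖((m t : ℝ)⁻¹ • ∑ j, A (s j) - (n : ℝ)⁻¹ • ∑ i, A i) x‖ ≤
      12 * K * √(Real.log p / m t) * ‖x‖} with hbad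
  have hmeas : MeasurableSet (S t ⁻¹' bad) := hS.measurable t bad.toFinite.measurableSet
  have hPbad : P.real (S t ⁻¹' bad) ≤ 1 / p := by
    rw [← map_measureReal_apply (hS.measurable t) bad.toFinite.measurableSet]
    exact NewSamp.uniformOn_norm_sampleMean_sub_mean_gt_le hA hKA (hm t) hn hp (hS.uniform t)
  have hgood : 1 - 2 / (p : ℝ) ≤ P.real (S t ⁻¹' bad)ᶜ := by
    rw [probReal_compl_eq_one_sub hmeas]
    have : (1 : ℝ) / p ≤ 2 / p := by gcongr; norm_num
    linarith
  refine hgood.trans ?_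
  -- Almost-everywhere inclusion suffices, without measurability of the target event. The step bound
  -- is pointwise, so `η t` may depend on `S t`.
  refine ENNReal.toReal_mono (measure_ne_top _ _) (measure_mono_ae ?_)
  filter_upwards [hη] with ω hω hωgood hlam
  obtain ⟨h0, h1⟩ := hω hlam
  have hδ : ∀ x, ‖(H t ω - (n : ℝ)⁻¹ • ∑ i, A i) x‖ ≤
      12 * K * √(Real.log p / m t) * ‖x‖ := by
    rw [hH]
    exact not_not.1 hωgood
  have hstep := NewSamp.norm_proj_step_sub_le hC hcl hstar (hHsymm ω) hlam h0 h1 hδ (θ t ω)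
  have hnext : θ (t + 1) ω = NewSamp.proj C (θ t ω - η t ω •
      NewSamp.scaling r (H t ω) (((n : ℝ)⁻¹ • ∑ i, A i) (θ t ω - θstar))) := by
    rw [← NewSamp.gradient_objective hgrad hmin]
    rfl
  rw [hnext]
  refine hstep.trans_eq ?_
  simp only [NewSamp.xi₁, lamP, lamR]
  ring
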